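/- **Conventions.** Let $m \ge 0$. A differential ring is a commutative ring with $m$ commuting derivations $\delta_1,\dots,\delta_m$, and a differential field is a differential ring that is a field of characteristic $0$. For a differential field $K$, a differential $K$-algebra is a differential ring $S$ with a $K$-algebra structure such that the structure map $K\to S$ commutes with the derivations. It is differentially finitely generated if it is generated as a $K$-algebra by the derivatives $\delta_1^{\xi_1}\cdots\delta_m^{\xi_m} g$ ($\xi\in\mathbb N^m$) of finitely many elements $g$. A differential $K$-rational point of $S$ is a $K$-algebra homomorphism $S\to K$ that commutes with the derivations. A $K$-rational point of a finitely generated $K$-algebra $A$ is a $K$-algebra homomorphism $A\to K$; it is smooth if $A$ is smooth over $K$ at its kernel. A polynomial $K$-algebra is one isomorphic to a polynomial ring over $K$ in a (possibly infinite) set of indeterminates. A field $K$ is large if every irreducible affine algebraic variety over $K$ with a smooth $K$-point has a Zariski-dense set of $K$-points. A field (respectively differential field) $K$ is existentially closed in an extension $L$ if every algebraic (respectively differential) variety over $K$ with an $L$-point has a $K$-point. A differential field $K$ is differentially large if it is large as a field and is existentially closed, as a differential field, in every differential field extension $L/K$ such that $K$ is existentially closed in $L$ as a field. **Theorem 5.5.**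 Let $K$ be a differential field that is large as a field. The following are equivalent. 1. $K$ is differentially large. 2. For every differentially finitely generated differential $K$-algebra $S$: if $S$ is a domain and there are $K$-algebras $A$ and $P$ with $S\cong A\otimes_K P$ as $K$-algebras such that (a) $A$ is a finitely generated $K$-algebra and a domain, (b) $P$ is a polynomial $K$-algebra, and (c) there is a smooth $K$-rational point $A\to K$, then there is a differential $K$-rational point $S\to K$. -/

import Mathlib

open scoped TensorProduct

universe u v w

/-- A commutative ring with `m` commuting derivations. -/
class PartialDiffRing (m : ℕ) (R : Type u) [CommRing R] where
  /-- The distinguished derivations `δ 0, …, δ (m - 1)`. -/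
  δ : Fin m → Derivation ℤ R R
  comm : ∀ (i j : Fin m) (x : R), δ i (δ j x) = δ j (δ i x)

/-- `S` is a differential `R`-algebra: the structure map commutes with the derivations. -/
class PartialDiffAlgebra (m : ℕ) (R : Type u) (S : Type v) [CommRing R] [CommRing S]
    [Algebra R S] [PartialDiffRing m R] [PartialDiffRing m S] : Prop where
  algebraMap_δ : ∀ (i : Fin m) (x : R),
    algebraMap R S (PartialDiffRing.δ i x) = PartialDiffRing.δ i (algebraMap R S x)

/-- The operator `δ^ξ = δ₁^ξ₁ ⋯ δₘ^ξₘ`. -/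
def iterDeriv {m : ℕ} {R : Type u} [CommRing R] [PartialDiffRing m R] (ξ : Fin m → ℕ) :
    Module.End ℤ R :=
  (List.ofFn fun i : Fin m =>
    ((PartialDiffRing.δ i : Derivation ℤ R R) : Module.End ℤ R) ^ ξ i).prod

/-- Differential polynomials over `K` in `n` differential indeterminates: polynomials in the
algebraic indeterminates `δ^ξ x_i`. -/
abbrev DiffPolynomial (m n : ℕ) (K : Type u) [CommRing K] :=
  MvPolynomial (Fin n × (Fin m → ℕ)) K

/-- Evaluation of differential polynomials over `K` at a tuple `a` of a differential `K`-algebra: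
`δ^ξ x_i` is sent to `δ^ξ (a i)`. -/
noncomputable def diffEval {m n : ℕ} (K : Type u) {S : Type v} [CommRing K] [CommRing S]
    [Algebra K S] [PartialDiffRing m S] (a : Fin n → S) : DiffPolynomial m n K →ₐ[K] S :=
  MvPolynomial.aeval fun v => iterDeriv v.2 (a v.1)

/-- A `K`-rational point `φ : A → K` is smooth if `A` is smooth over `K` at the prime `ker φ`. -/
def IsSmoothRationalPoint {K : Type u} {A : Type v} [Field K] [CommRing A] [Algebra K A]
    (φ : A →ₐ[K] K) : Prop :=
  (⟨RingHom.ker φ, RingHom.ker_isPrime φ⟩ : PrimeSpectrum A) ∈ Algebra.smoothLocus K A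

/-- A field `K` is large if every irreducible affine variety over `K` (given by its coordinate ring
`A`, a finitely generated `K`-algebra that is a domain) with a smooth `K`-point has a Zariski-dense
set of `K`-points: every nonempty basic open set `f ≠ 0` contains a `K`-point. -/
def IsLargeField (K : Type u) [Field K] : Prop :=
  ∀ (A : Type u) [CommRing A] [IsDomain A] [Algebra K A], Algebra.FiniteType K A →
    (∃ φ : A →ₐ[K] K, IsSmoothRationalPoint φ) →
      ∀ f : A, f ≠ 0 → ∃ ψ : A →ₐ[K] K, ψ f ≠ 0

/-- `K` is existentially closed in `L` as a field: every affine algebraic variety over `K` with an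
`L`-point has a `K`-point. -/
def IsFieldEC (K : Type u) (L : Type v) [Field K] [Field L] [Algebra K L] : Prop :=
  ∀ (n : ℕ) (F : Set (MvPolynomial (Fin n) K)),
    (∃ a : Fin n → L, ∀ p ∈ F, MvPolynomial.aeval a p = 0) →
      ∃ a : Fin n → K, ∀ p ∈ F, MvPolynomial.aeval a p = 0

/-- `K` is existentially closed in `L` as a differential field: every affine differential variety
over `K` with an `L`-point has a `K`-point. -/
def IsDiffFieldEC (m : ℕ) (K : Type u) (L : Type v) [Field K] [Field L] [Algebra K L]
    [PartialDiffRing m K] [PartialDiffRing m L] : Prop :=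
  ∀ (n : ℕ) (F : Set (DiffPolynomial m n K)),
    (∃ a : Fin n → L, ∀ p ∈ F, diffEval K a p = 0) →
      ∃ a : Fin n → K, ∀ p ∈ F, diffEval K a p = 0

/-- A differential field `K` is differentially large if it is large as a field and is existentially
closed as a differential field in every differential field extension in which it is existentially
closed as a field.  Extensions in the universe of `K` suffice: a tuple of any extension
lies in a differential subfield, differentially finitely generated over `K`, which has a copy
in that universe. -/
def IsDifferentiallyLarge (m : ℕ) (K : Type u) [Field K] [PartialDiffRing m K] : Prop :=
  IsLargeField K ∧
    ∀ (L : Type u) [Field L] [Algebra K L] [PartialDiffRing m L] [PartialDiffAlgebra m K L],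
      IsFieldEC K L → IsDiffFieldEC m K L

/-- `S` is differentially finitely generated over `K`: it is generated as a `K`-algebra by all
derivatives `δ^ξ g` of the elements `g` of a finite set. -/
def IsDiffFinitelyGenerated (m : ℕ) (K : Type u) (S : Type v) [CommRing K] [CommRing S]
    [Algebra K S] [PartialDiffRing m S] : Prop :=
  ∃ G : Finset S, Algebra.adjoin K {s : S | ∃ g ∈ G, ∃ ξ : Fin m → ℕ, s = iterDeriv ξ g} = ⊤

/-- `P` is a polynomial algebra over `K`, in an arbitrary set of indeterminates. -/
def IsPolynomialAlgebra (K : Type u) (P : Type v) [CommRing K] [CommRing P] [Algebra K P] : Prop :=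
  ∃ σ : Type v, Nonempty (P ≃ₐ[K] MvPolynomial σ K)

/-- A `K`-algebra homomorphism is differential if it commutes with the derivations. -/
def IsDiffHom (m : ℕ) {K : Type u} {S : Type v} {T : Type w} [CommRing K] [CommRing S] [CommRing T]
    [Algebra K S] [Algebra K T] [PartialDiffRing m S] [PartialDiffRing m T]
    (φ : S →ₐ[K] T) : Prop :=
  ∀ (i : Fin m) (s : S), φ (PartialDiffRing.δ i s) = PartialDiffRing.δ i (φ s)

/-! From differential largeness to points: `S` is a polynomial ring over `A`. For `t ≠ 0` in `S`,
largeness moves the smooth point of `A` off the zeros of some nonzero coefficient of `t`, and the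
variables can then be specialised because `K` is infinite. So the `K`-points of `S` are dense, and
clearing denominators makes `K` existentially closed in `Frac S` as a field
(`IsFieldEC.of_forall_exists_ne_zero`). The derivations extend to `Frac S`, where the generators of
`S` solve all their own differential relations; a solution in `K` is a differential point.

Conversely, let `a` be a solution in `L`. Rank the derivatives of `a` by an orderly ranking and call
one a leader if it is algebraic over those of lower rank. By Dickson's lemma the leaders are shifts
of finitely many. Differentiating an algebraic relation gives one that is linear in its leading
derivative with the separant as coefficient, so once the product `h` of the separants is inverted,
every leader of large order can be eliminated. The remaining derivatives of large order are
algebraically independent over the algebra `A` generated by `h⁻¹` and the derivatives of small order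
(`exists_algebraicIndependent_adjoin`). Existential closedness and generic smoothness give `A` a
smooth point, so the hypothesis applies to `K{a}[h⁻¹]`, and its differential point maps `a` to a
solution in `K`. -/

/-! ### Iterated derivations and differential homomorphisms. -/

section IterDeriv

variable {m : ℕ} {R : Type u} [CommRing R] [PartialDiffRing m R]

theorem multiIndex_induction {p : (Fin m → ℕ) → Prop} (zero : p 0)
    (single_add : ∀ i ξ, p ξ → p (Pi.single i 1 + ξ)) (ξ : Fin m → ℕ) : p ξ := by
  induction h : ∑ i, ξ i generalizing ξ with
  | zero =>
    have : ξ = 0 := by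
      ext i
      exact (Finset.sum_eq_zero_iff.mp h) i (Finset.mem_univ i)
    exact this ▸ zero
  | succ d ih =>
    obtain ⟨i, hi⟩ : ∃ i, ξ i ≠ 0 := by
      by_contra! hc
      simp [hc] at h
    have hξ : ξ = Pi.single i 1 + (ξ - Pi.single i 1) := by
      ext j
      by_cases hj : j = i
      · subst hj
        simp only [Pi.add_apply, Pi.single_eq_same, Pi.sub_apply]
        omega
      · simp [hj]
    rw [hξ]
    refine single_add i _ (ih _ ?_)
    rw [hξ] at h
    simp only [Pi.add_apply, Finset.sum_add_distrib, Finset.sum_pi_single', Finset.mem_univ,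
      if_true] at h
    have h1 : ∑ x, (Pi.single i 1 : Fin m → ℕ) x = 1 := by simp
    omega

theorem List.ofFn_prod_pow_single_add {M : Type*} [Monoid M] {m : ℕ} (f : Fin m → M)
    (hf : ∀ i j, Commute (f i) (f j)) (j : Fin m) (ξ : Fin m → ℕ) :
    (List.ofFn fun i => f i ^ (Pi.single j 1 + ξ : Fin m → ℕ) i).prod =
      f j * (List.ofFn fun i => f i ^ ξ i).prod := by
  induction m with
  | zero => exact j.elim0
  | succ m ih =>
    simp only [List.ofFn_succ, List.prod_cons]
    cases j using Fin.cases with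
    | zero => simp [pow_add, mul_assoc]
    | succ j =>
      have := ih (fun i => f i.succ) (fun i k => hf _ _) j (fun i => ξ i.succ)
      have h2 : ∀ i : Fin m, (Pi.single j.succ 1 + ξ : Fin (m + 1) → ℕ) i.succ =
          ((Pi.single j 1 + fun i => ξ i.succ) : Fin m → ℕ) i := by
        intro i
        simp [Pi.single_apply]
      simp only [h2, this]
      simp only [Pi.add_apply, ne_eq, (Fin.succ_ne_zero j).symm, not_false_eq_true,
        Pi.single_eq_of_ne, zero_add, ← mul_assoc]
      rw [((hf 0 j.succ).pow_left (ξ 0)).eq]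

theorem iterDeriv_zero (x : R) : iterDeriv (0 : Fin m → ℕ) x = x := by
  have : (List.ofFn fun i : Fin m =>
    ((PartialDiffRing.δ i : Derivation ℤ R R) : Module.End ℤ R) ^ (0 : Fin m → ℕ) i).prod = 1 := by
    apply List.prod_eq_one
    simp
  rw [iterDeriv, this]
  rfl

theorem iterDeriv_single_add (i : Fin m) (ξ : Fin m → ℕ) (x : R) :
    iterDeriv (Pi.single i 1 + ξ) x = PartialDiffRing.δ i (iterDeriv ξ x) := by
  rw [iterDeriv, List.ofFn_prod_pow_single_add]
  · rfl
  · intro i j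
    ext y
    exact PartialDiffRing.comm i j y

variable {K : Type u} [CommRing K] {S : Type v} {T : Type w} [CommRing S] [CommRing T]
  [Algebra K S] [Algebra K T] [PartialDiffRing m S] [PartialDiffRing m T]

theorem IsDiffHom.map_iterDeriv {φ : S →ₐ[K] T} (hφ : IsDiffHom m φ) (ξ : Fin m → ℕ) (s : S) :
    φ (iterDeriv ξ s) = iterDeriv ξ (φ s) := by
  induction ξ using multiIndex_induction with
  | zero => simp [iterDeriv_zero]
  | single_add i ξ ih => rw [iterDeriv_single_add, iterDeriv_single_add, hφ, ih]

theorem IsDiffHom.map_diffEval {φ : S →ₐ[K] T} (hφ : IsDiffHom m φ) {n : ℕ} (a : Fin n → S)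
    (p : DiffPolynomial m n K) : φ (diffEval K a p) = diffEval K (φ ∘ a) p := by
  have : φ.comp (diffEval K a) = diffEval K (m := m) (φ ∘ a) := by
    ext v
    simp [diffEval, hφ.map_iterDeriv]
  rw [← this]
  rfl

theorem IsDiffHom.of_adjoin_eq_top [PartialDiffRing m K] [PartialDiffAlgebra m K S]
    [PartialDiffAlgebra m K T] {φ : S →ₐ[K] T} {G : Set S} (hG : Algebra.adjoin K G = ⊤)
    (h : ∀ i : Fin m, ∀ g ∈ G, φ (PartialDiffRing.δ i g) = PartialDiffRing.δ i (φ g)) :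
    IsDiffHom m φ := by
  intro i s
  have hs : s ∈ Algebra.adjoin K G := hG ▸ trivial
  induction hs using Algebra.adjoin_induction with
  | mem x hx => exact h i x hx
  | algebraMap k =>
    rw [← PartialDiffAlgebra.algebraMap_δ, φ.commutes, φ.commutes,
      PartialDiffAlgebra.algebraMap_δ]
  | add x y _ _ hx hy => simp [hx, hy]
  | mul x y _ _ hx hy => simp [hx, hy]

end IterDeriv

/-! ### Extending derivations to the fraction field. -/

section FractionRing

variable {S : Type u} [CommRing S] (F : Type v) [Field F] [Algebra S F] [IsFractionRing S F]

/-- Localisation is formally étale, so `Ω[F]` is the base change of `Ω[S]` and the linear map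
classifying `D` extends `F`-linearly. -/
theorem Derivation.exists_extend_fractionRing [IsDomain S] (D : Derivation ℤ S S) :
    ∃ D' : Derivation ℤ F F, ∀ s, D' (algebraMap S F s) = algebraMap S F (D s) := by
  have : Algebra.FormallyEtale S F := .of_isLocalization (nonZeroDivisors S)
  let D₁ : Derivation ℤ S F :=
    (Algebra.linearMap S F).compDer D
  refine ⟨((D₁.liftKaehlerDifferential.liftBaseChange F) ∘ₗ
    (KaehlerDifferential.tensorKaehlerEquivOfFormallyEtale ℤ S F).symm.toLinearMap).compDer
      (KaehlerDifferential.D ℤ F), fun s => ?_⟩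
  have : KaehlerDifferential.D ℤ F (algebraMap S F s) =
      KaehlerDifferential.tensorKaehlerEquivOfFormallyEtale ℤ S F
        (1 ⊗ₜ KaehlerDifferential.D ℤ S s) := by
    simp
  change D₁.liftKaehlerDifferential.liftBaseChange F
    ((KaehlerDifferential.tensorKaehlerEquivOfFormallyEtale ℤ S F).symm
      (KaehlerDifferential.D ℤ F (algebraMap S F s))) = _
  rw [this, LinearEquiv.symm_apply_apply, LinearMap.liftBaseChange_tmul, one_smul,
    Derivation.liftKaehlerDifferential_comp_D]
  rfl

theorem Derivation.eq_zero_of_fractionRing [IsDomain S] (D : Derivation ℤ F F)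
    (h : ∀ s, D (algebraMap S F s) = 0) : D = 0 := by
  ext x
  obtain ⟨a, b, hb, rfl⟩ := IsFractionRing.div_surjective (A := S) x
  have hb' : algebraMap S F b ≠ 0 := by
    simpa using nonZeroDivisors.ne_zero hb
  have : algebraMap S F a = algebraMap S F b * (algebraMap S F a / algebraMap S F b) := by
    field_simp
  have h2 := congrArg D this
  rw [D.leibniz, h, h, smul_zero, add_zero, smul_eq_mul, eq_comm, mul_eq_zero] at h2
  simpa using h2.resolve_left hb'

/-- The extensions commute because their commutators are derivations of `F` vanishing on `S`. -/
theorem PartialDiffRing.exists_fractionRing (m : ℕ) [IsDomain S] [PartialDiffRing m S] :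
    ∃ _ : PartialDiffRing m F, PartialDiffAlgebra m S F := by
  choose D hD using fun i : Fin m =>
    Derivation.exists_extend_fractionRing F (PartialDiffRing.δ i : Derivation ℤ S S)
  refine ⟨⟨D, fun i j x => ?_⟩, @PartialDiffAlgebra.mk _ _ _ _ _ _ _ (_) fun i s => (hD i s).symm⟩
  have : ⁅D i, D j⁆ = 0 := by
    refine Derivation.eq_zero_of_fractionRing (S := S) F _ fun s => ?_
    simp [Derivation.commutator_apply, hD, PartialDiffRing.comm i j]
  have := congrArg (fun E => E x) this
  simpa [Derivation.commutator_apply, sub_eq_zero] using this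

end FractionRing

/-! ### Density of rational points and existential closedness. -/

section LargeField

variable {K : Type u} [Field K]

theorem MvPolynomial.exists_aeval_ne_zero [Infinite K] {σ : Type v} {t : MvPolynomial σ K}
    (ht : t ≠ 0) : ∃ x : σ → K, MvPolynomial.aeval x t ≠ 0 := by
  by_contra! h
  exact ht (MvPolynomial.funext fun x => by simpa [MvPolynomial.aeval_eq_eval] using h x)

theorem IsLargeField.exists_mvPolynomial_point_ne_zero [Infinite K] (hK : IsLargeField K)
    {A : Type u} [CommRing A] [IsDomain A] [Algebra K A] (hA : Algebra.FiniteType K A)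
    (hφ : ∃ φ : A →ₐ[K] K, IsSmoothRationalPoint φ) {σ : Type v} {t : MvPolynomial σ A}
    (ht : t ≠ 0) : ∃ ψ : MvPolynomial σ A →ₐ[K] K, ψ t ≠ 0 := by
  obtain ⟨d, hd⟩ := MvPolynomial.ne_zero_iff.mp ht
  obtain ⟨ψ, hψ⟩ := hK A hA hφ _ hd
  have : MvPolynomial.mapAlgHom ψ t ≠ 0 := by
    refine MvPolynomial.ne_zero_iff.mpr ⟨d, ?_⟩
    simpa [MvPolynomial.coeff_map] using hψ
  obtain ⟨x, hx⟩ := MvPolynomial.exists_aeval_ne_zero this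
  exact ⟨(MvPolynomial.aeval x).comp (MvPolynomial.mapAlgHom ψ), hx⟩

/-- With `t` a common denominator of a solution in `F`, the solution lies in `S[1/t] ⊆ F`, and a
point with `ψ t ≠ 0` extends to `S[1/t]`. -/
theorem IsFieldEC.of_forall_exists_ne_zero {S : Type v} {F : Type w} [CommRing S] [IsDomain S]
    [Algebra K S] [Field F] [Algebra S F] [IsFractionRing S F] [Algebra K F] [IsScalarTower K S F]
    (h : ∀ t : S, t ≠ 0 → ∃ ψ : S →ₐ[K] K, ψ t ≠ 0) : IsFieldEC K F := by
  rintro n P ⟨a, ha⟩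
  obtain ⟨⟨t, ht⟩, hb⟩ := IsLocalization.exist_integer_multiples_of_finite (nonZeroDivisors S) a
  choose s hs using hb
  have ht0 : t ≠ 0 := nonZeroDivisors.ne_zero ht
  obtain ⟨ψ, hψ⟩ := h t ht0
  have hFt : algebraMap S F t ≠ 0 := by simpa using ht0
  let St := Localization.Away t
  let ι : St →ₐ[K] F := IsLocalization.liftAlgHom (M := Submonoid.powers t)
    (f := IsScalarTower.toAlgHom K S F) (by
      rintro ⟨_, k, rfl⟩
      simp [ht0])
  have hι : Function.Injective ι := by
    refine (IsLocalization.lift_injective_iff _).mpr fun x y => ?_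
    rw [(IsLocalization.injective St (powers_le_nonZeroDivisors_of_noZeroDivisors ht0)).eq_iff]
    exact (IsFractionRing.injective S F).eq_iff.symm
  let ψ' : St →ₐ[K] K := IsLocalization.liftAlgHom (M := Submonoid.powers t) (f := ψ) (by
      rintro ⟨_, k, rfl⟩
      simp [hψ])
  let b : Fin n → St := fun i => IsLocalization.mk' St (s i) ⟨t, Submonoid.mem_powers t⟩
  have hb : ∀ i, ι (b i) = a i := by
    intro i
    have h1 : ι (b i * algebraMap S St t) = algebraMap S F t * a i := by
      have := hs i
      rw [Algebra.smul_def] at this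
      rw [← this, IsLocalization.mk'_spec]
      exact IsLocalization.lift_eq _ _
    have h2 : ι (algebraMap S St t) = algebraMap S F t := IsLocalization.lift_eq _ _
    rw [map_mul, h2, mul_comm] at h1
    exact mul_left_cancel₀ hFt h1
  refine ⟨fun i => ψ' (b i), fun p hp => ?_⟩
  have h1 : MvPolynomial.aeval b p = 0 := by
    apply hι
    rw [map_zero, ← ha p hp, MvPolynomial.comp_aeval_apply]
    simp [hb]
  have := congrArg ψ' h1
  rwa [map_zero, MvPolynomial.comp_aeval_apply] at this

end LargeField

/-! ### Differential points as solutions of differential equations. -/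

section DiffPoint

variable {m : ℕ} {K : Type u} [Field K] {S : Type v} [CommRing S] [Algebra K S]
  [PartialDiffRing m S]

theorem diffEval_surjective_iff {n : ℕ} (g : Fin n → S) :
    Function.Surjective (diffEval (m := m) K g) ↔
      Algebra.adjoin K (Set.range fun v : Fin n × (Fin m → ℕ) => iterDeriv v.2 (g v.1)) = ⊤ := by
  rw [Algebra.adjoin_range_eq_range_aeval, AlgHom.range_eq_top]
  rfl

theorem IsDiffFinitelyGenerated.exists_diffEval_surjective
    (hS : IsDiffFinitelyGenerated m K S) :
    ∃ (n : ℕ) (g : Fin n → S), Function.Surjective (diffEval (m := m) K g) := by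
  obtain ⟨G, hG⟩ := hS
  refine ⟨G.card, fun i => (G.equivFin.symm i : S), ?_⟩
  rw [diffEval_surjective_iff, ← hG]
  congr 1
  ext s
  constructor
  · rintro ⟨⟨j, ξ⟩, rfl⟩
    exact ⟨_, (G.equivFin.symm j).2, ξ, rfl⟩
  · rintro ⟨g, hg, ξ, rfl⟩
    exact ⟨(G.equivFin ⟨g, hg⟩, ξ), by simp⟩

variable [PartialDiffRing m K] [PartialDiffAlgebra m K S]

/-- `S` is the differential polynomial ring modulo the relations of `g`, so `a` induces an algebra
map; compatibility with the derivations needs checking only on the generators `δ^ξ g_j`. -/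
theorem exists_isDiffHom_of_diffEval {n : ℕ} {g : Fin n → S}
    (hg : Function.Surjective (diffEval (m := m) K g)) (a : Fin n → K)
    (ha : ∀ p : DiffPolynomial m n K, diffEval K g p = 0 → diffEval K a p = 0) :
    ∃ φ : S →ₐ[K] K, IsDiffHom m φ := by
  let φ : S →ₐ[K] K := (Ideal.Quotient.liftₐ (RingHom.ker (diffEval (m := m) K g))
    (diffEval K a) ha).comp (Ideal.quotientKerAlgEquivOfSurjective hg).symm.toAlgHom
  have hφ : ∀ p : DiffPolynomial m n K, φ (diffEval K g p) = diffEval K a p := by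
    intro p
    have : (Ideal.quotientKerAlgEquivOfSurjective hg).symm (diffEval (m := m) K g p) =
        Ideal.Quotient.mk _ p := by
      rw [AlgEquiv.symm_apply_eq]
      rfl
    change Ideal.Quotient.liftₐ (RingHom.ker (diffEval (m := m) K g)) (diffEval K a) ha
      ((Ideal.quotientKerAlgEquivOfSurjective hg).symm _) = _
    rw [this]
    rfl
  have hφX : ∀ (j : Fin n) (ξ : Fin m → ℕ), 
      φ (iterDeriv ξ (g j)) = iterDeriv ξ (a j) := by
    intro j ξ
    have := hφ (MvPolynomial.X (j, ξ))
    simpa [diffEval] using this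
  have : PartialDiffAlgebra m K K := ⟨fun _ _ => rfl⟩
  refine ⟨φ, IsDiffHom.of_adjoin_eq_top ((diffEval_surjective_iff g).mp hg) ?_⟩
  rintro i _ ⟨⟨j, ξ⟩, rfl⟩
  simp only
  rw [← iterDeriv_single_add, hφX, hφX, iterDeriv_single_add]

theorem IsDiffFieldEC.exists_isDiffHom {L : Type w} [Field L] [Algebra K L] [PartialDiffRing m L]
    (hL : IsDiffFieldEC m K L) (hS : IsDiffFinitelyGenerated m K S) (ι : S →ₐ[K] L)
    (hι : IsDiffHom m ι) : ∃ φ : S →ₐ[K] K, IsDiffHom m φ := by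
  obtain ⟨n, g, hg⟩ := hS.exists_diffEval_surjective
  obtain ⟨a, ha⟩ := hL n {p | diffEval K g p = 0}
    ⟨ι ∘ g, fun p hp => by rw [← hι.map_diffEval, Set.mem_ofPred.mp hp, map_zero]⟩
  exact exists_isDiffHom_of_diffEval hg a ha

end DiffPoint

/-! ### Differential largeness yields differential points. -/

theorem IsDifferentiallyLarge.exists_isDiffHom {m : ℕ} {K : Type u} [Field K] [CharZero K]
    [PartialDiffRing m K] (hK : IsDifferentiallyLarge m K) {S : Type u} [CommRing S] [IsDomain S]
    [Algebra K S] [PartialDiffRing m S] [PartialDiffAlgebra m K S]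
    (hS : IsDiffFinitelyGenerated m K S) {A P : Type u} [CommRing A] [CommRing P] [Algebra K A]
    [Algebra K P] (e : S ≃ₐ[K] A ⊗[K] P) [IsDomain A] (hA : Algebra.FiniteType K A)
    (hP : IsPolynomialAlgebra K P) (hφ : ∃ φ : A →ₐ[K] K, IsSmoothRationalPoint φ) :
    ∃ φ : S →ₐ[K] K, IsDiffHom m φ := by
  obtain ⟨σ, ⟨eP⟩⟩ := hP
  let e' : S ≃ₐ[K] MvPolynomial σ A := (e.trans (Algebra.TensorProduct.congr .refl eP)).trans
    ((MvPolynomial.algebraTensorAlgEquiv K A).restrictScalars K)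
  let F := FractionRing S
  obtain ⟨_, hF⟩ := PartialDiffRing.exists_fractionRing (S := S) F m
  have : PartialDiffAlgebra m K F := ⟨fun i x => by
    rw [IsScalarTower.algebraMap_apply K S F, PartialDiffAlgebra.algebraMap_δ,
      hF.algebraMap_δ, ← IsScalarTower.algebraMap_apply K S F]⟩
  have hEC : IsFieldEC K F := by
    refine IsFieldEC.of_forall_exists_ne_zero (S := S) fun t ht => ?_
    obtain ⟨ψ, hψ⟩ := hK.1.exists_mvPolynomial_point_ne_zero hA hφ (t := e' t) (by simpa using ht)
    exact ⟨ψ.comp e'.toAlgHom, hψ⟩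
  exact (hK.2 F hEC).exists_isDiffHom hS (IsScalarTower.toAlgHom K S F)
    fun i s => hF.algebraMap_δ i s

/-! ### An orderly ranking of derivatives. -/

section Ranking

/-- Indices of the derivatives `δ^ξ x_j` of `n` differential indeterminates, to be ordered by an
orderly ranking. -/
def DerivIndex (m n : ℕ) : Type := Fin n × (Fin m → ℕ)

namespace DerivIndex

variable {m n : ℕ}

/-- The order of the derivative `δ^ξ x_j`. -/
def ord (v : DerivIndex m n) : ℕ := ∑ i, v.2 i

/-- Comparing keys gives the ranking: first by order, then by indeterminate, then
lexicographically. -/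
def key (v : DerivIndex m n) : ℕ ×ₗ (Fin n ×ₗ Lex (Fin m → ℕ)) :=
  toLex (v.ord, toLex (v.1, toLex v.2))

theorem key_injective : Function.Injective (key (m := m) (n := n)) := by
  rintro ⟨j, ξ⟩ ⟨k, ζ⟩ h
  have h1 := congrArg (fun x => (ofLex x).2) h
  have h2 := congrArg (fun x => (ofLex x).1) h1
  have h3 := congrArg (fun x => (ofLex x).2) h1
  exact Prod.ext h2 (congrArg ofLex h3)

noncomputable instance : LinearOrder (DerivIndex m n) := LinearOrder.lift' key key_injective

theorem lt_iff_key {v w : DerivIndex m n} : v < w ↔ key v < key w := Iff.rfl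

instance : WellFoundedLT (DerivIndex m n) :=
  ⟨InvImage.wf key (wellFounded_lt (α := ℕ ×ₗ (Fin n ×ₗ Lex (Fin m → ℕ))))⟩

/-- The index of `δ^ζ δ^ξ x_j`. -/
def shift (ζ : Fin m → ℕ) (v : DerivIndex m n) : DerivIndex m n := (v.1, ζ + v.2)

theorem ord_shift (ζ : Fin m → ℕ) (v : DerivIndex m n) : (shift ζ v).ord = ∑ i, ζ i + v.ord := by
  simp [ord, shift, Finset.sum_add_distrib]

theorem shift_zero (v : DerivIndex m n) : shift 0 v = v :=
  Prod.ext rfl (zero_add _)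

theorem shift_add (ζ η : Fin m → ℕ) (v : DerivIndex m n) :
    shift (ζ + η) v = shift ζ (shift η v) :=
  Prod.ext rfl (add_assoc _ _ _)

theorem ord_le_of_lt {v w : DerivIndex m n} (h : v < w) : v.ord ≤ w.ord := by
  rw [lt_iff_key, key, key, Prod.Lex.toLex_lt_toLex] at h
  rcases h with h | h
  · exact h.le
  · exact h.1.le

theorem lt_of_ord_lt {v w : DerivIndex m n} (h : v.ord < w.ord) : v < w := by
  rw [lt_iff_key, key, key, Prod.Lex.toLex_lt_toLex]
  exact Or.inl h

theorem shift_strictMono (ζ : Fin m → ℕ) : StrictMono (shift (n := n) ζ) := by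
  intro v w h
  rw [lt_iff_key] at h ⊢
  simp only [key, Prod.Lex.toLex_lt_toLex, ord_shift] at h ⊢
  rcases h with h | ⟨h, h' | ⟨h', h''⟩⟩
  · left
    omega
  · exact Or.inr ⟨by omega, Or.inl h'⟩
  · refine Or.inr ⟨by omega, Or.inr ⟨h', ?_⟩⟩
    exact (add_lt_add_iff_left (toLex ζ)).mpr h''

theorem sum_pos_of_ne_zero {ζ : Fin m → ℕ} (h : ζ ≠ 0) : 0 < ∑ i, ζ i := by
  by_contra hc
  refine h (funext fun i => ?_)
  exact Finset.sum_eq_zero_iff.mp (Nat.eq_zero_of_not_pos hc) i (Finset.mem_univ i)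

theorem lt_shift {ζ : Fin m → ℕ} (h : ζ ≠ 0) (v : DerivIndex m n) : v < shift ζ v := by
  have := sum_pos_of_ne_zero h
  exact lt_of_ord_lt (by rw [ord_shift]; omega)

theorem finite_ord_le (d : ℕ) : {v : DerivIndex m n | v.ord ≤ d}.Finite := by
  refine ((Set.finite_univ (α := Fin n)).prod
    (Set.finite_Iic (fun _ : Fin m => d))).subset ?_
  rintro ⟨j, ξ⟩ h
  refine ⟨trivial, fun i => le_trans ?_ h⟩
  exact Finset.single_le_sum (f := ξ) (fun _ _ => Nat.zero_le _) (Finset.mem_univ i)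

/-- Dickson's lemma. -/
theorem exists_finset_shift (E : Set (DerivIndex m n)) :
    ∃ M : Finset (DerivIndex m n), ↑M ⊆ E ∧ ∀ v ∈ E, ∃ u ∈ M, ∃ ζ, v = shift ζ u := by
  let E' : Fin n → Set (Fin m → ℕ) := fun j => {ξ | (j, ξ) ∈ (E : Set (Fin n × (Fin m → ℕ)))}
  have hfin : ∀ j, {ξ | Minimal (· ∈ E' j) ξ}.Finite := fun j =>
    WellQuasiOrderedLE.finite_of_isAntichain (setOfPred_minimal_antichain _)
  have hfin' : (⋃ j, (fun ξ => ((j, ξ) : DerivIndex m n)) '' {ξ | Minimal (· ∈ E' j) ξ}).Finite :=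
    Set.finite_iUnion fun j => (hfin j).image _
  refine ⟨hfin'.toFinset, ?_, ?_⟩
  · intro v hv
    obtain ⟨_, ⟨j, rfl⟩, ξ, hξ, rfl⟩ := hfin'.mem_toFinset.mp hv
    exact hξ.prop
  · rintro ⟨j, ξ⟩ hv
    obtain ⟨ξ', hle, hmin⟩ := Set.IsPWO.exists_le_minimal (s := E' j)
      (Set.isPWO_of_wellQuasiOrderedLE _) hv
    refine ⟨(j, ξ'), hfin'.mem_toFinset.mpr (Set.mem_iUnion.mpr ⟨j, ξ', hmin, rfl⟩), ξ - ξ', ?_⟩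
    exact Prod.ext rfl (tsub_add_cancel_of_le hle).symm

end DerivIndex

end Ranking

/-! ### Algebraic relations and their separants. -/

section Separant

/-- For a nonzero relation of least degree, the derivative has smaller degree and is nonzero in
characteristic zero, so it cannot vanish at `x`. -/
theorem IsAlgebraic.exists_aeval_eq_zero_derivative_ne_zero {R : Type u} {L : Type v} [CommRing R]
    [IsDomain R] [CharZero R] [CommRing L] [IsDomain L] [Algebra R L]
    (hRL : Function.Injective (algebraMap R L)) {x : L} (hx : IsAlgebraic R x) :
    ∃ p : Polynomial R, Polynomial.aeval x p = 0 ∧ Polynomial.aeval x p.derivative ≠ 0 := by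
  obtain ⟨p, ⟨hp0, hp⟩, hmin⟩ := exists_minimalFor_of_wellFoundedLT
    (fun p : Polynomial R => p ≠ 0 ∧ Polynomial.aeval x p = 0) Polynomial.natDegree hx
  refine ⟨p, hp, fun hd => ?_⟩
  by_cases hdeg : p.natDegree = 0
  · rw [Polynomial.eq_C_of_natDegree_eq_zero hdeg, Polynomial.aeval_C,
      map_eq_zero_iff _ hRL] at hp
    exact hp0 (by rw [Polynomial.eq_C_of_natDegree_eq_zero hdeg, hp, map_zero])
  · have hlt := Polynomial.natDegree_derivative_lt hdeg
    have h0 : p.derivative ≠ 0 := fun h =>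
      hdeg (Polynomial.derivative_eq_zero.mp h)
    exact absurd (hmin ⟨h0, hd⟩ hlt.le) (not_le.mpr hlt)

/-- By the Leibniz rule the difference is `p` with `D` applied to its coefficients, evaluated at
`x`. -/
theorem Derivation.map_aeval_sub_mem {L : Type v} [CommRing L] {K : Type u} [CommRing K]
    [Algebra K L] {B C : Subalgebra K L} (D : Derivation ℤ L L) (hB : ∀ b ∈ B, D b ∈ C)
    {x : L} (hx : x ∈ C) (p : Polynomial B) :
    D (Polynomial.aeval x p) - Polynomial.aeval x p.derivative * D x ∈ C := by
  induction p using Polynomial.induction_on' with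
  | add p q hp hq =>
    simp only [map_add]
    convert C.add_mem hp hq using 1
    ring
  | monomial k b =>
    have hc : ∀ c : B, algebraMap B L c = c := fun _ => rfl
    rw [Polynomial.aeval_monomial, Polynomial.derivative_monomial, Polynomial.aeval_monomial,
      D.leibniz, D.leibniz_pow, hc, hc]
    have : x ^ k * D (b : L) ∈ C := C.mul_mem (C.pow_mem hx k) (hB _ b.2)
    convert this using 1
    simp only [smul_eq_mul, nsmul_eq_mul, MulMemClass.coe_mul, SubringClass.coe_natCast]
    ring

theorem Derivation.map_mem_of_mem_adjoin {L : Type v} [CommRing L] {K : Type u} [CommRing K]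
    [Algebra K L] {C : Subalgebra K L} (D : Derivation ℤ L L)
    (hK : ∀ k, D (algebraMap K L k) ∈ C) {G : Set L} (hG : G ⊆ C) (hD : ∀ g ∈ G, D g ∈ C)
    {x : L} (hx : x ∈ Algebra.adjoin K G) : D x ∈ C := by
  have hle : Algebra.adjoin K G ≤ C := Algebra.adjoin_le hG
  induction hx using Algebra.adjoin_induction with
  | mem x hx => exact hD x hx
  | algebraMap k => exact hK k
  | add x y _ _ hx hy => simpa using C.add_mem hx hy
  | mul x y hx' hy' hx hy =>
    rw [D.leibniz]
    exact C.add_mem (C.mul_mem (hle hx') hy) (C.mul_mem (hle hy') hx)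

end Separant

/-! ### Derivatives of a tuple, filtered by rank. -/

section DerivedTuple

variable {m n : ℕ} {K : Type u} {L : Type v} [Field K] [Field L] [Algebra K L]
  [PartialDiffRing m L]

/-- The derivatives `δ^ξ a_j` of a tuple `a`. -/
def derivTuple (a : Fin n → L) (v : DerivIndex m n) : L := iterDeriv v.2 (a v.1)

theorem δ_derivTuple (a : Fin n → L) (i : Fin m) (v : DerivIndex m n) :
    PartialDiffRing.δ i (derivTuple a v) = derivTuple a (v.shift (Pi.single i 1)) :=
  (iterDeriv_single_add i v.2 (a v.1)).symm

variable (K) in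
/-- The subalgebra generated by the derivatives of rank less than `v`. -/
abbrev adjoinLT (a : Fin n → L) (v : DerivIndex m n) : Subalgebra K L :=
  Algebra.adjoin K (derivTuple a '' Set.Iio v)

variable (K) in
/-- The subalgebra generated by the derivatives of rank at most `v`. -/
abbrev adjoinLE (a : Fin n → L) (v : DerivIndex m n) : Subalgebra K L :=
  Algebra.adjoin K (derivTuple a '' Set.Iic v)

variable {a : Fin n → L} {v w : DerivIndex m n}

theorem adjoinLE_le_adjoinLT (h : v < w) : adjoinLE K a v ≤ adjoinLT K a w :=
  Algebra.adjoin_mono (Set.image_mono (Set.Iic_subset_Iio.mpr h))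

theorem derivTuple_mem_adjoinLT (h : v < w) : derivTuple a v ∈ adjoinLT K a w :=
  Algebra.subset_adjoin ⟨v, h, rfl⟩

theorem single_one_ne_zero (i : Fin m) : (Pi.single i 1 : Fin m → ℕ) ≠ 0 := by
  simp

variable [PartialDiffRing m K] [PartialDiffAlgebra m K L]

theorem δ_mem_of_mem_adjoin {C : Subalgebra K L} (i : Fin m) {G : Set L} (hG : G ⊆ C)
    (hD : ∀ g ∈ G, PartialDiffRing.δ i g ∈ C) {x : L} (hx : x ∈ Algebra.adjoin K G) :
    PartialDiffRing.δ i x ∈ C :=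
  Derivation.map_mem_of_mem_adjoin _
    (fun k => by rw [← PartialDiffAlgebra.algebraMap_δ]; exact C.algebraMap_mem _) hG hD hx

theorem δ_mem_adjoinLT (i : Fin m) {x : L} (hx : x ∈ adjoinLT K a v) :
    PartialDiffRing.δ i x ∈ adjoinLT K a (v.shift (Pi.single i 1)) := by
  refine δ_mem_of_mem_adjoin i ?_ ?_ hx
  · rintro _ ⟨w, hw, rfl⟩
    exact derivTuple_mem_adjoinLT (hw.trans (DerivIndex.lt_shift (single_one_ne_zero i) v))
  · rintro _ ⟨w, hw, rfl⟩
    rw [δ_derivTuple]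
    exact derivTuple_mem_adjoinLT (DerivIndex.shift_strictMono _ hw)

theorem δ_mem_adjoinLE (i : Fin m) {x : L} (hx : x ∈ adjoinLE K a v) :
    PartialDiffRing.δ i x ∈ adjoinLE K a (v.shift (Pi.single i 1)) := by
  refine δ_mem_of_mem_adjoin i ?_ ?_ hx
  · rintro _ ⟨w, hw, rfl⟩
    exact Algebra.subset_adjoin
      ⟨w, le_trans hw (DerivIndex.lt_shift (single_one_ne_zero i) v).le, rfl⟩
  · rintro _ ⟨w, hw, rfl⟩
    rw [δ_derivTuple]
    exact Algebra.subset_adjoin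
      (Set.mem_image_of_mem _ ((DerivIndex.shift_strictMono _).monotone hw))

/-- If `δ^ξ a_j` is algebraic over the derivatives of lower rank, the proper derivatives of an
algebraic relation are linear in their leading derivative, with the separant as coefficient. -/
theorem exists_separant [CharZero K] (hv : IsAlgebraic (adjoinLT K a v) (derivTuple a v)) :
    ∃ s ∈ adjoinLE K a v, s ≠ 0 ∧
      ∀ ζ ≠ 0, s * derivTuple a (v.shift ζ) ∈ adjoinLT K a (v.shift ζ) := by
  have : CharZero (adjoinLT K a v) := charZero_of_injective_algebraMap
    (FaithfulSMul.algebraMap_injective K (adjoinLT K a v))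
  obtain ⟨p, hp, hp'⟩ := hv.exists_aeval_eq_zero_derivative_ne_zero Subtype.val_injective
  have hle : adjoinLT K a v ≤ adjoinLE K a v :=
    Algebra.adjoin_mono (Set.image_mono Set.Iio_subset_Iic_self)
  have hs : Polynomial.aeval (derivTuple a v) p.derivative ∈ adjoinLE K a v := by
    rw [Polynomial.aeval_eq_sum_range]
    refine Subalgebra.sum_mem _ fun k _ => ?_
    rw [Algebra.smul_def]
    exact Subalgebra.mul_mem _ (hle (p.derivative.coeff k).2)
      (Subalgebra.pow_mem _ (Algebra.subset_adjoin (Set.mem_image_of_mem _ (Set.mem_Iic.mpr le_rfl))) k)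
  refine ⟨_, hs, hp', fun ζ => ?_⟩
  induction ζ using multiIndex_induction with
  | zero => exact fun h => absurd rfl h
  | single_add i ζ ih =>
    intro _
    have hi := single_one_ne_zero i
    by_cases hζ : ζ = 0
    · subst hζ
      rw [add_zero]
      have := Derivation.map_aeval_sub_mem (PartialDiffRing.δ i : Derivation ℤ L L)
        (fun b hb => δ_mem_adjoinLT i hb)
        (derivTuple_mem_adjoinLT (DerivIndex.lt_shift hi v)) p
      rw [hp, map_zero, zero_sub, δ_derivTuple] at this
      exact neg_mem_iff.mp this
    -- Apply `δ i` to the product: the term containing `δ i s` has lower rank because `ζ ≠ 0`, so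
    -- the other term is also in the subalgebra.
    · have h1 := δ_mem_adjoinLT i (ih hζ)
      have hlt : v.shift (Pi.single i 1) < v.shift (Pi.single i 1 + ζ) := by
        rw [add_comm, DerivIndex.shift_add]
        exact DerivIndex.lt_shift hζ _
      have h2 := adjoinLE_le_adjoinLT (K := K) (a := a) hlt (δ_mem_adjoinLE i hs)
      have h3 : derivTuple a (v.shift ζ) ∈ adjoinLT K a (v.shift (Pi.single i 1 + ζ)) := by
        rw [DerivIndex.shift_add]
        exact derivTuple_mem_adjoinLT (DerivIndex.lt_shift hi _)
      rw [← DerivIndex.shift_add, Derivation.leibniz, δ_derivTuple, ← DerivIndex.shift_add,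
        smul_eq_mul, smul_eq_mul] at h1
      exact (add_mem_cancel_right (mul_mem h3 h2)).mp h1

end DerivedTuple

/-! ### The structure theorem. -/

section Structure

theorem Transcendental.intermediateField_adjoin {K : Type u} {L : Type v} [Field K] [Field L]
    [Algebra K L] {s : Set L} {x : L} (hx : Transcendental (Algebra.adjoin K s) x) :
    Transcendental (IntermediateField.adjoin K s) x := by
  open scoped IntermediateField.algebraAdjoinAdjoin in
  exact fun h => hx ((IsFractionRing.isAlgebraic_iff (Algebra.adjoin K s)
    (IntermediateField.adjoin K s) L).mpr h)

/-- A family in a field is algebraically independent over a subring if each member is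
transcendental over a subfield containing the subring and the preceding members. -/
theorem algebraicIndependent_of_transcendental {ι : Type w} [LinearOrder ι] {L : Type v} [Field L]
    {K : Type u} [Field K] [Algebra K L] (A : Subalgebra K L) (y : ι → L)
    (F : ι → IntermediateField K L) (hAF : ∀ i, ∀ x ∈ A, x ∈ F i)
    (hyF : ∀ i j, j < i → y j ∈ F i) (h : ∀ i, Transcendental (F i) (y i)) :
    AlgebraicIndependent A y := by
  refine algebraicIndependent_of_finite_type fun t ht => ?_
  lift t to Finset ι using ht
  classical
  induction t using Finset.induction_on_max with
  | empty =>
    have : IsEmpty ((∅ : Finset ι) : Set ι) := by simp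
    exact algebraicIndependent_empty_type_iff.mpr Subtype.val_injective
  | insert i s hlt ih =>
    rw [Finset.coe_insert]
    refine AlgebraicIndepOn.insert ih fun halg => h i ?_
    have hle : ∀ x ∈ Algebra.adjoin A (y '' s), x ∈ F i := by
      intro x hx
      induction hx using Algebra.adjoin_induction with
      | mem x hx =>
        obtain ⟨j, hj, rfl⟩ := hx
        exact hyF i j (hlt j hj)
      | algebraMap k => exact hAF i k k.2
      | add x z _ _ hx hz => exact add_mem hx hz
      | mul x z _ _ hx hz => exact mul_mem hx hz
    let f : Algebra.adjoin A (y '' s) →+* F i :=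
      { toFun := fun x => ⟨x, hle x x.2⟩
        map_one' := rfl
        map_mul' := fun _ _ => rfl
        map_zero' := rfl
        map_add' := fun _ _ => rfl }
    exact halg.ringHom_of_comp_eq (S := F i) f (RingHom.id L)
      (fun x z hxz => Subtype.ext (congrArg (fun u : F i => (u : L)) hxz)) rfl

variable {m n : ℕ} {K : Type u} {L : Type v} [Field K] [CharZero K] [Field L] [Algebra K L]
  [PartialDiffRing m K] [PartialDiffRing m L] [PartialDiffAlgebra m K L]

/-- Structure theorem: after inverting one element, the differential algebra generated by a finite
tuple is a polynomial algebra over a finitely generated algebra. -/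
theorem exists_algebraicIndependent_adjoin (a : Fin n → L) :
    ∃ (W : Set (DerivIndex m n)) (V : Set (DerivIndex m n)) (h : L), W.Finite ∧ h ≠ 0 ∧
      h ∈ Algebra.adjoin K (derivTuple a '' W) ∧
      AlgebraicIndependent (Algebra.adjoin K (insert h⁻¹ (derivTuple a '' W)))
        (fun v : V => derivTuple a (v : DerivIndex m n)) ∧
      Algebra.adjoin K (insert h⁻¹ (Set.range (derivTuple (m := m) a))) =
        Algebra.adjoin K (insert h⁻¹ (derivTuple a '' W)) ⊔
          Algebra.adjoin K (derivTuple a '' V) := by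
  classical
  let E : Set (DerivIndex m n) := {v | IsAlgebraic (adjoinLT K a v) (derivTuple a v)}
  obtain ⟨M, hME, hM⟩ := DerivIndex.exists_finset_shift E
  have hsep : ∀ u : DerivIndex m n, ∃ s : L, u ∈ E → s ∈ adjoinLE K a u ∧ s ≠ 0 ∧
      ∀ ζ ≠ 0, s * derivTuple a (u.shift ζ) ∈ adjoinLT K a (u.shift ζ) := by
    intro u
    by_cases hu : u ∈ E
    · obtain ⟨s, h⟩ := exists_separant hu
      exact ⟨s, fun _ => h⟩
    -- Junk value outside `E`, never used.
    · exact ⟨0, fun h => absurd h hu⟩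
  choose s hs using hsep
  -- With this bound, `W` contains `M` and every derivative occurring in its separants.
  let d := M.sup DerivIndex.ord
  let W : Set (DerivIndex m n) := {v | v.ord ≤ d}
  let V : Set (DerivIndex m n) := {v | v ∉ E ∧ d < v.ord}
  have hsW : ∀ u ∈ M, s u ∈ Algebra.adjoin K (derivTuple a '' W) := by
    intro u hu
    refine Algebra.adjoin_mono (Set.image_mono fun w hw => ?_) (hs u (hME hu)).1
    have h1 : w.ord ≤ u.ord := by
      rcases eq_or_lt_of_le (Set.mem_Iic.mp hw) with h | h
      · rw [h]
      · exact DerivIndex.ord_le_of_lt h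
    exact h1.trans (Finset.le_sup (f := DerivIndex.ord) hu)
  let h := ∏ u ∈ M, s u
  have h0 : h ≠ 0 := Finset.prod_ne_zero_iff.mpr fun u hu => (hs u (hME hu)).2.1
  have hW : h ∈ Algebra.adjoin K (derivTuple a '' W) := prod_mem hsW
  refine ⟨W, V, h, DerivIndex.finite_ord_le d, h0, hW, ?_, le_antisymm ?_ ?_⟩
  -- Orders in `V` exceed `d`, so all of `W`, hence also `h⁻¹`, lies in the field generated by the
  -- derivatives ranked below any given member of `V`.
  · refine algebraicIndependent_of_transcendental _ _
      (fun v => IntermediateField.adjoin K (derivTuple a '' Set.Iio (v : DerivIndex m n)))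
      ?_ ?_ fun v => Transcendental.intermediateField_adjoin v.2.1
    · intro v
      have hle : Algebra.adjoin K (derivTuple a '' W) ≤ (IntermediateField.adjoin K
          (derivTuple a '' Set.Iio (v : DerivIndex m n))).toSubalgebra := by
        refine Algebra.adjoin_le ?_
        rintro _ ⟨w, hw, rfl⟩
        exact IntermediateField.subset_adjoin _ _
          ⟨w, DerivIndex.lt_of_ord_lt (lt_of_le_of_lt hw v.2.2), rfl⟩
      suffices hle' : Algebra.adjoin K (insert h⁻¹ (derivTuple a '' W)) ≤
          (IntermediateField.adjoin K
            (derivTuple a '' Set.Iio (v : DerivIndex m n))).toSubalgebra from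
        fun x hx => hle' hx
      refine Algebra.adjoin_le (Set.insert_subset ?_ (Algebra.subset_adjoin.trans hle))
      exact IntermediateField.inv_mem _ (hle hW)
    · intro v w hlt
      exact IntermediateField.subset_adjoin _ _ ⟨w, hlt, rfl⟩
  · refine Algebra.adjoin_le (Set.insert_subset ?_ ?_)
    · exact (le_sup_left : _ ≤ _ ⊔ Algebra.adjoin K (derivTuple a '' V))
        (Algebra.subset_adjoin (Set.mem_insert _ _))
    · set C := Algebra.adjoin K (insert h⁻¹ (derivTuple a '' W)) ⊔
        Algebra.adjoin K (derivTuple a '' V) with hC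
      have hinv : h⁻¹ ∈ C := (le_sup_left : _ ≤ C) (Algebra.subset_adjoin (Set.mem_insert _ _))
      have hWC : Algebra.adjoin K (derivTuple a '' W) ≤ C :=
        (Algebra.adjoin_mono (Set.subset_insert _ _)).trans le_sup_left
      rintro _ ⟨w, rfl⟩
      -- Induction on rank: a leader of order above `d` is a proper shift of some `u ∈ M`, so `s u`
      -- times it is a polynomial in lower derivatives, and `s u` divides the unit `h`.
      induction w using WellFoundedLT.induction with
      | ind w ih =>
        by_cases hwd : w.ord ≤ d
        · exact hWC (Algebra.subset_adjoin ⟨w, hwd, rfl⟩)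
        by_cases hwE : w ∈ E
        · obtain ⟨u, hu, ζ, rfl⟩ := hM w hwE
          have hζ : ζ ≠ 0 := by
            rintro rfl
            rw [DerivIndex.shift_zero] at hwd
            exact hwd (Finset.le_sup (f := DerivIndex.ord) hu)
          have h1 : s u * derivTuple a (u.shift ζ) ∈ C := by
            refine (Algebra.adjoin_le ?_ : adjoinLT K a (u.shift ζ) ≤ C)
              ((hs u (hME hu)).2.2 ζ hζ)
            rintro _ ⟨w, hw, rfl⟩
            exact ih w hw
          have h2 : ∏ t ∈ M.erase u, s t ∈ C :=
            prod_mem fun t ht => hWC (hsW t (Finset.mem_of_mem_erase ht))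
          have h3 : h = (∏ t ∈ M.erase u, s t) * s u := (Finset.prod_erase_mul M s hu).symm
          have h4 : derivTuple a (u.shift ζ) =
              h⁻¹ * ((∏ t ∈ M.erase u, s t) * (s u * derivTuple a (u.shift ζ))) := by
            rw [← mul_assoc (∏ t ∈ M.erase u, s t), ← h3, inv_mul_cancel_left₀ h0]
          rw [h4]
          exact mul_mem hinv (mul_mem h2 h1)
        · exact (le_sup_right : _ ≤ C)
            (Algebra.subset_adjoin ⟨w, ⟨hwE, not_le.mp hwd⟩, rfl⟩)
  · exact sup_le
      (Algebra.adjoin_mono (Set.insert_subset_insert (Set.image_subset_range _ _)))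
      (Algebra.adjoin_mono ((Set.image_subset_range _ _).trans (Set.subset_insert _ _)))

end Structure

/-! ### Smooth points from existential closedness. -/

section SmoothPoints

/-- Over a perfect field the fraction field is formally smooth, so the generic point lies in the
smooth locus, which is open. -/
theorem exists_basicOpen_subset_smoothLocus (K : Type u) [Field K] [PerfectField K] (A : Type v)
    [CommRing A] [IsDomain A] [Algebra K A] [Algebra.FiniteType K A] :
    ∃ g : A, g ≠ 0 ∧ ↑(PrimeSpectrum.basicOpen g) ⊆ Algebra.smoothLocus K A := by
  have : Algebra.FinitePresentation K A := Algebra.FinitePresentation.of_finiteType.mp ‹_›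
  have : Algebra.EssFiniteType A (FractionRing A) := .of_isLocalization _ (nonZeroDivisors A)
  have : Algebra.EssFiniteType K (FractionRing A) := .comp K A _
  have : IsLocalization.AtPrime (FractionRing A) (⊥ : Ideal A) := by
    rw [IsLocalization.AtPrime, Ideal.primeCompl_bot]
    infer_instance
  have hbot : (⊥ : PrimeSpectrum A) ∈ Algebra.smoothLocus K A :=
    Algebra.FormallySmooth.of_equiv ((IsLocalization.algEquiv (⊥ : Ideal A).primeCompl
      (FractionRing A) (Localization.AtPrime (⊥ : Ideal A))).restrictScalars K)
  obtain ⟨_, ⟨_, ⟨g, rfl⟩, rfl⟩, hg, hsub⟩ :=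
    PrimeSpectrum.isBasis_basic_opens.exists_subset_of_mem_open hbot
      Algebra.isOpen_smoothLocus
  exact ⟨g, fun h => hg (by simp [h]), hsub⟩

theorem IsFieldEC.exists_algHom {K : Type u} {L : Type v} [Field K] [Field L] [Algebra K L]
    (h : IsFieldEC K L) {T : Type w} [CommRing T] [Algebra K T] [Algebra.FiniteType K T]
    (ι : T →ₐ[K] L) : Nonempty (T →ₐ[K] K) := by
  obtain ⟨n, f, hf⟩ := Algebra.FiniteType.iff_quotient_mvPolynomial''.mp ‹Algebra.FiniteType K T›
  obtain ⟨b, hb⟩ := h n {p | f p = 0} ⟨fun i => ι (f (MvPolynomial.X i)), fun p hp => by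
    rw [← MvPolynomial.comp_aeval_apply, ← MvPolynomial.comp_aeval_apply,
      MvPolynomial.aeval_X_left_apply, Set.mem_ofPred.mp hp, map_zero]⟩
  exact ⟨(Ideal.Quotient.liftₐ (RingHom.ker f) (MvPolynomial.aeval b) hb).comp
    (Ideal.quotientKerAlgEquivOfSurjective hf).symm.toAlgHom⟩

/-- Adjoining `g⁻¹` inside `L`, with `D(g)` in the smooth locus, forces the point found in `K` to be
smooth. -/
theorem IsFieldEC.exists_isSmoothRationalPoint {K : Type u} {L : Type v} [Field K] [CharZero K]
    [Field L] [Algebra K L] (h : IsFieldEC K L) (A : Subalgebra K L) (hA : A.FG) :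
    ∃ φ : A →ₐ[K] K, IsSmoothRationalPoint φ := by
  have : Algebra.FiniteType K A := A.fg_iff_finiteType.mp hA
  obtain ⟨g, hg0, hg⟩ := exists_basicOpen_subset_smoothLocus K A
  let B := A ⊔ Algebra.adjoin K {(g : L)⁻¹}
  have hB : B.FG := hA.sup (Subalgebra.fg_def.mpr ⟨_, Set.finite_singleton _, rfl⟩)
  have : Algebra.FiniteType K B := B.fg_iff_finiteType.mp hB
  obtain ⟨ψ⟩ := h.exists_algHom B.val
  have hAB : A ≤ B := le_sup_left
  refine ⟨ψ.comp (Subalgebra.inclusion hAB), hg ?_⟩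
  let g' : B := ⟨(g : L)⁻¹, (le_sup_right : _ ≤ B) (Algebra.self_mem_adjoin_singleton K _)⟩
  have hg' : Subalgebra.inclusion hAB g * g' = 1 :=
    Subtype.ext (mul_inv_cancel₀ fun h0 => hg0 (Subtype.ext h0))
  have h1 := congrArg ψ hg'
  rw [map_mul, map_one] at h1
  exact left_ne_zero_of_mul_eq_one h1

end SmoothPoints

/-! ### Polynomial and differential subalgebras of `L`. -/

section Subalgebras

theorem AlgebraicIndependent.nonempty_sup_adjoin_algEquiv {K : Type u} {L : Type v} [Field K]
    [Field L] [Algebra K L] {A : Subalgebra K L} {ι : Type w} {y : ι → L}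
    (hy : AlgebraicIndependent A y) :
    Nonempty (↥(A ⊔ Algebra.adjoin K (Set.range y)) ≃ₐ[K] A ⊗[K] MvPolynomial ι K) := by
  let f : MvPolynomial ι A →ₐ[K] L := (MvPolynomial.aeval y : _ →ₐ[A] L).restrictScalars K
  have hf : Function.Injective f := hy
  have hfC : ∀ x : A, f (MvPolynomial.C x) = x := fun x => MvPolynomial.aeval_C y x
  have hfX : ∀ i, f (MvPolynomial.X i) = y i := fun i => MvPolynomial.aeval_X y i
  have hr : f.range = A ⊔ Algebra.adjoin K (Set.range y) := by
    refine le_antisymm ?_ (sup_le ?_ (Algebra.adjoin_le ?_))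
    · rintro _ ⟨p, rfl⟩
      change f p ∈ _
      induction p using MvPolynomial.induction_on with
      | C x => exact hfC x ▸ (le_sup_left : A ≤ _) x.2
      | add p q hp hq => exact map_add f p q ▸ add_mem hp hq
      | mul_X p i hp =>
        rw [map_mul, hfX]
        exact mul_mem hp ((le_sup_right : _ ≤ A ⊔ _) (Algebra.subset_adjoin ⟨i, rfl⟩))
    · exact fun x hx => ⟨MvPolynomial.C ⟨x, hx⟩, hfC _⟩
    · rintro _ ⟨i, rfl⟩
      exact ⟨MvPolynomial.X i, hfX i⟩
  let e : A ⊗[K] MvPolynomial ι K ≃ₐ[A] MvPolynomial ι A :=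
    MvPolynomial.algebraTensorAlgEquiv K A
  exact ⟨((Subalgebra.equivOfEq _ _ hr.symm).trans (AlgEquiv.ofInjective f hf).symm).trans
    (e.restrictScalars K).symm⟩

variable {m : ℕ} {K : Type u} {L : Type v} [Field K] [Field L] [Algebra K L]
  [PartialDiffRing m L]

/-- The differential ring structure on a subalgebra closed under the derivations. -/
abbrev Subalgebra.partialDiffRing (B : Subalgebra K L)
    (hB : ∀ i : Fin m, ∀ x ∈ B, PartialDiffRing.δ i x ∈ B) : PartialDiffRing m B where
  δ i := Derivation.mk'
    (AddMonoidHom.toIntLinearMap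
      { toFun := fun x => ⟨PartialDiffRing.δ i (x : L), hB i x x.2⟩
        map_zero' := Subtype.ext (map_zero _)
        map_add' := fun x y => Subtype.ext (map_add _ (x : L) (y : L)) })
    fun x y => Subtype.ext (Derivation.leibniz _ (x : L) (y : L))
  comm i j x := Subtype.ext (PartialDiffRing.comm i j (x : L))

variable [PartialDiffRing m K] [PartialDiffAlgebra m K L]

/-- Closure under `δ i` at `h⁻¹` follows from `δ (h⁻¹) = -h⁻² δ h`, where `δ h` stays in the algebra
because `h` is a polynomial in the derivatives of `a`. -/
theorem δ_mem_adjoin_insert_inv {n : ℕ} {a : Fin n → L} {h : L}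
    (hh : h ∈ Algebra.adjoin K (Set.range (derivTuple (m := m) a))) (i : Fin m) {x : L}
    (hx : x ∈ Algebra.adjoin K (insert h⁻¹ (Set.range (derivTuple (m := m) a)))) :
    PartialDiffRing.δ i x ∈
      Algebra.adjoin K (insert h⁻¹ (Set.range (derivTuple (m := m) a))) := by
  set C := Algebra.adjoin K (insert h⁻¹ (Set.range (derivTuple (m := m) a))) with hC
  have hG : Set.range (derivTuple (m := m) a) ⊆ C :=
    (Set.subset_insert _ _).trans Algebra.subset_adjoin
  have hD : ∀ g ∈ Set.range (derivTuple (m := m) a), PartialDiffRing.δ i g ∈ C := by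
    rintro _ ⟨v, rfl⟩
    rw [δ_derivTuple]
    exact hG ⟨_, rfl⟩
  have hinv : h⁻¹ ∈ C := Algebra.subset_adjoin (Set.mem_insert _ _)
  refine δ_mem_of_mem_adjoin i Algebra.subset_adjoin ?_ hx
  rintro g (rfl | hg)
  · rw [Derivation.leibniz_inv, smul_eq_mul, neg_mul]
    exact neg_mem (mul_mem (pow_mem hinv 2) (δ_mem_of_mem_adjoin i hG hD hh))
  · exact hD g hg

end Subalgebras

/-! ### Differential points yield differential largeness, and the equivalence. -/

theorem IsDifferentiallyLarge.of_exists_isDiffHom (m : ℕ) (K : Type u) [Field K] [CharZero K]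
    [PartialDiffRing m K] (hK : IsLargeField K)
    (H : ∀ (S : Type u) [CommRing S] [IsDomain S] [Algebra K S] [PartialDiffRing m S]
        [PartialDiffAlgebra m K S],
        IsDiffFinitelyGenerated m K S →
        (∃ (A P : Type u) (_ : CommRing A) (_ : CommRing P) (_ : Algebra K A) (_ : Algebra K P),
          Nonempty (S ≃ₐ[K] A ⊗[K] P) ∧
          IsDomain A ∧ Algebra.FiniteType K A ∧
          IsPolynomialAlgebra K P ∧
          ∃ φ : A →ₐ[K] K, IsSmoothRationalPoint φ) →
        ∃ φ : S →ₐ[K] K, IsDiffHom m φ) : IsDifferentiallyLarge m K := by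
  classical
  refine ⟨hK, fun L _ _ _ _ hL n F => ?_⟩
  rintro ⟨a, ha⟩
  obtain ⟨W, V, h, hWfin, h0, hhW, hind, heq⟩ := exists_algebraicIndependent_adjoin (m := m)
    (K := K) a
  let A := Algebra.adjoin K (insert h⁻¹ (derivTuple a '' W))
  let S := Algebra.adjoin K (insert h⁻¹ (Set.range (derivTuple (m := m) a)))
  have hh : h ∈ Algebra.adjoin K (Set.range (derivTuple (m := m) a)) :=
    Algebra.adjoin_mono (Set.image_subset_range _ _) hhW
  let _ : PartialDiffRing m S :=
    S.partialDiffRing fun i x hx => δ_mem_adjoin_insert_inv hh i hx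
  have hval : IsDiffHom m S.val := fun i x => rfl
  have : PartialDiffAlgebra m K S :=
    ⟨fun i x => Subtype.ext (PartialDiffAlgebra.algebraMap_δ (S := L) i x)⟩
  have haS : ∀ j, a j ∈ S := fun j =>
    Algebra.subset_adjoin (Set.mem_insert_of_mem _ ⟨(j, 0), iterDeriv_zero _⟩)
  let a' : Fin n → S := fun j => ⟨a j, haS j⟩
  let hinv : S := ⟨h⁻¹, Algebra.subset_adjoin (Set.mem_insert _ _)⟩
  have hAfg : A.FG := Subalgebra.fg_def.mpr ⟨_, (hWfin.image _).insert _, rfl⟩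
  have hfg : IsDiffFinitelyGenerated m K S := by
    refine ⟨insert hinv (Finset.univ.image a'), top_le_iff.mp ?_⟩
    rw [← Algebra.adjoin_adjoin_coe_preimage]
    refine Algebra.adjoin_mono ?_
    rintro s (hs | ⟨⟨j, ξ⟩, hs⟩)
    · exact ⟨hinv, by simp, 0, by rw [iterDeriv_zero]; exact Subtype.ext hs⟩
    · refine ⟨a' j, by simp, ξ, Subtype.ext (hs.symm.trans ?_)⟩
      exact (hval.map_iterDeriv ξ (a' j)).symm
  -- `V` lives in `Type`; lifting it puts the polynomial algebra in the universe of `K`.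
  have hind' := hind.comp (ULift.down : ULift.{u} V → V) ULift.down_injective
  obtain ⟨e⟩ := hind'.nonempty_sup_adjoin_algEquiv
  have hrange : Set.range ((fun v : V => derivTuple a (v : DerivIndex m n)) ∘
      (ULift.down : ULift.{u} V → V)) = derivTuple a '' V := by
    rw [ULift.down_surjective.range_comp, Set.image_eq_range]
  rw [hrange] at e
  obtain ⟨φ, hφ⟩ := H S hfg ⟨A, MvPolynomial (ULift.{u} V) K, inferInstance, inferInstance,
    inferInstance, inferInstance, ⟨(Subalgebra.equivOfEq _ _ heq).trans e⟩, inferInstance,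
    A.fg_iff_finiteType.mp hAfg, ⟨_, ⟨AlgEquiv.refl⟩⟩, hL.exists_isSmoothRationalPoint A hAfg⟩
  refine ⟨φ ∘ a', fun p hp => ?_⟩
  have hp0 : diffEval K a' p = 0 := by
    apply Subtype.val_injective
    exact (hval.map_diffEval a' p).trans (ha p hp)
  rw [← hφ.map_diffEval, hp0, map_zero]

theorem theorem5p5 (m : ℕ) (K : Type u) [Field K] [CharZero K] [PartialDiffRing m K]
    (hK : IsLargeField K) :
    IsDifferentiallyLarge m K ↔
      ∀ (S : Type u) [CommRing S] [IsDomain S] [Algebra K S] [PartialDiffRing m S]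
        [PartialDiffAlgebra m K S],
        IsDiffFinitelyGenerated m K S →
        (∃ (A P : Type u) (_ : CommRing A) (_ : CommRing P) (_ : Algebra K A) (_ : Algebra K P),
          Nonempty (S ≃ₐ[K] A ⊗[K] P) ∧
          IsDomain A ∧ Algebra.FiniteType K A ∧
          IsPolynomialAlgebra K P ∧
          ∃ φ : A →ₐ[K] K, IsSmoothRationalPoint φ) →
        ∃ φ : S →ₐ[K] K, IsDiffHom m φ := by
  refine ⟨fun h S _ _ _ _ _ hS => ?_, IsDifferentiallyLarge.of_exists_isDiffHom m K hK⟩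
  rintro ⟨A, P, _, _, _, _, ⟨e⟩, _, hA, hP, hφ⟩
  exact h.exists_isDiffHom hS e hA hP hφ
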